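/- For a probability measure $\mu$ on $\mathbb{R}^n$ let $\|Y\|_{\psi_2(\mu)}=\inf\{u>0:\mathbb{E}_\mu\exp(Y^2/u^2)\le 2\}\in[0,\infty]$, and for $T\subset\mathbb{R}^n$ let $$\gamma_2(T,\psi_2)=\inf_{(T_s)}\ \sup_{t\in T}\ \sum_{s=0}^\infty 2^{s/2}\,\inf_{a\in T_s}\|\langle t,\cdot\rangle-\langle a,\cdot\rangle\|_{\psi_2(\mu)}\in[0,\infty],$$ where the infimum is over all sequences of non-empty subsets $T_s\subset T$ with $|T_0|=1$ and $|T_s|\le 2^{2^s}$ for $s\ge1$; put $\gamma_2(\emptyset,\psi_2)=0$. Call $\mu$ isotropic if $\int\langle x,y\rangle^2\,d\mu(x)=\|y\|^2$ for every $y\in\mathbb{R}^n$, and log-concave if $\mu(\lambda A+(1-\lambda)B)\ge\mu(A)^\lambda\mu(B)^{1-\lambda}$ for all Borel sets $A,B$ and $0<\lambda<1$. **Theorem.** For every $0<\delta<1$ there is a constant $c=c(\delta)>0$ such that the following holds for all integers $n\ge 0$ and $k\ge1$. Let $\mu$ be an isotropic, log-concave probability measure on $\mathbb{R}^n$, let $K\subset\mathbb{R}^n$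 be a convex symmetric body (compact, convex, $K=-K$, with non-empty interior), let $X_1,\dots,X_k$ be independent random vectors distributed according to $\mu$, and let $\Gamma=\sum_{i=1}^k\langle X_i,\cdot\rangle e_i:\mathbb{R}^n\to\mathbb{R}^k$. Write $V_\rho=\gamma_2(K\cap\rho S^{n-1},\psi_2)$ and $$q_k^*(K)=\inf\Big\{\rho>0:\ V_\rho<\infty,\ \rho\ge c\,V_\rho\sqrt{\frac{\max\{1,\log V_\rho\}}{k}}\Big\},\qquad \tilde q_k(K)=\inf\Big\{\rho>0:\ V_\rho<\infty,\ \rho\ge c\,V_\rho\sqrt{\frac{\max\{1,V_\rho\}}{k}}\Big\},$$ with the convention $V\sqrt{\max\{1,\log V\}}=0$ for $V=0$. Then, with probability at least $1-\delta$, $$\mathrm{diam}(\ker\Gamma\cap K)\le 2\,q_k^*(K)\quad\text{and}\quad \mathrm{diam}(\ker\Gamma\cap K)\le 2\,\tilde q_k(K);$$ equivalently (as $\ker\Gamma\cap K$ is symmetric), every $x\in\ker\Gamma\cap K$ satisfies $\|x\|\le q_k^*(K)$ and $\|x\|\le\tilde q_k(K)$. -/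

import Mathlib

open MeasureTheory ProbabilityTheory
open scoped ENNReal Pointwise

noncomputable section

/-- The measure `μ` on `ℝⁿ` is isotropic: `∫ ⟨x, y⟩² dμ(x) = ‖y‖²` for all `y` (no centering is
required). The integrals are automatically finite: for `y ≠ 0` the value is non-zero. -/
def IsIsotropic {n : ℕ} (μ : Measure (EuclideanSpace ℝ (Fin n))) : Prop :=
  ∀ y : EuclideanSpace ℝ (Fin n), ∫ x, |inner ℝ x y| ^ 2 ∂μ = ‖y‖ ^ 2

/-- The measure `μ` on `ℝⁿ` is log-concave:
`μ (l A + (1 - l) B) ≥ μ(A)^l μ(B)^(1-l)` for Borel sets `A`, `B` and `0 < l < 1`. -/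
def IsLogConcaveMeasure {n : ℕ} (μ : Measure (EuclideanSpace ℝ (Fin n))) : Prop :=
  ∀ l : ℝ, 0 < l → l < 1 → ∀ A B : Set (EuclideanSpace ℝ (Fin n)),
    MeasurableSet A → MeasurableSet B →
      μ A ^ l * μ B ^ (1 - l) ≤ μ (l • A + (1 - l) • B)

/-- Convex symmetric body in `ℝⁿ`: compact, convex, symmetric about `0`, non-empty interior. -/
structure IsConvexSymmetricBody {n : ℕ} (K : Set (EuclideanSpace ℝ (Fin n))) : Prop where
  convex : Convex ℝ K
  isCompact : IsCompact K
  symm : ∀ x ∈ K, -x ∈ K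
  interior_nonempty : (interior K).Nonempty

/-- The norm `‖Y‖_{ψ_α} = inf {u > 0 : 𝔼 exp (|Y|^α / u^α) ≤ 2}`, with value `∞` if no `u` is
admissible. -/
def psiNorm {Ω : Type*} [MeasurableSpace Ω] (α : ℝ) (P : Measure Ω) (Y : Ω → ℝ) : ℝ≥0∞ :=
  ⨅ (u : ℝ) (_ : 0 < u)
    (_ : ∫⁻ ω, ENNReal.ofReal (Real.exp (|Y ω| ^ α / u ^ α)) ∂P ≤ 2), ENNReal.ofReal u

/-- The `ψ_α(μ)` distance on `ℝⁿ`, points being identified with linear functionals: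
`(s, t) ↦ ‖⟨s, ·⟩ - ⟨t, ·⟩‖_{ψ_α(μ)}`. -/
def psiDist {n : ℕ} (α : ℝ) (μ : Measure (EuclideanSpace ℝ (Fin n)))
    (s t : EuclideanSpace ℝ (Fin n)) : ℝ≥0∞ :=
  psiNorm α μ (fun x => inner ℝ s x - inner ℝ t x)

/-- Admissible sequences of subsets of `T`: `|S₀| ≤ 1` and `|S_s| ≤ 2^(2^s)` for `s ≥ 1`.
Sequences with an empty term are harmless for `T ≠ ∅`, since the distance to the empty set is `∞`
below; for `T = ∅` they make the functional `0`. -/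
structure IsAdmissibleSeq {M : Type*} (T : Set M) (S : ℕ → Set M) : Prop where
  subset : ∀ s, S s ⊆ T
  card_zero : (S 0).encard ≤ 1
  card_le : ∀ s, 1 ≤ s → (S s).encard ≤ 2 ^ (2 ^ s)

/-- Talagrand's functional
`γ_β(T, d) = inf_{(S_s)} sup_{t ∈ T} ∑_{s ≥ 0} 2^(s/β) d(t, S_s)`,
the infimum being over admissible sequences. -/
def talagrandGamma {M : Type*} (β : ℝ) (d : M → M → ℝ≥0∞) (T : Set M) : ℝ≥0∞ :=
  ⨅ (S : ℕ → Set M) (_ : IsAdmissibleSeq T S),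
    ⨆ t ∈ T, ∑' s : ℕ, (2 : ℝ≥0∞) ^ ((s : ℝ) / β) * ⨅ a ∈ S s, d t a

/-- `V_ρ = γ₂(K ∩ ρ S^{n-1}, ψ₂(μ))`. -/
def gammaSection {n : ℕ} (μ : Measure (EuclideanSpace ℝ (Fin n)))
    (K : Set (EuclideanSpace ℝ (Fin n))) (ρ : ℝ) : ℝ≥0∞ :=
  talagrandGamma 2 (psiDist 2 μ) (K ∩ Metric.sphere 0 ρ)

/-- `inf {ρ > 0 : V_ρ < ∞ and ρ ≥ c V_ρ √(w(V_ρ) / k)}`. For bounded `K` the set is never empty,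
because `V_ρ = 0` as soon as `K` does not meet the sphere of radius `ρ`. -/
def qStar {n : ℕ} (w : ℝ → ℝ) (c : ℝ) (k : ℕ) (μ : Measure (EuclideanSpace ℝ (Fin n)))
    (K : Set (EuclideanSpace ℝ (Fin n))) : ℝ :=
  sInf {ρ : ℝ | 0 < ρ ∧ gammaSection μ K ρ ≠ ∞ ∧
    c * (gammaSection μ K ρ).toReal * √(w (gammaSection μ K ρ).toReal / k) ≤ ρ}

/-- The operator `Γ = ∑ᵢ ⟨xᵢ, ·⟩ eᵢ : ℝⁿ → ℝᵏ`. -/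
def sampleOperator {n k : ℕ} (x : Fin k → EuclideanSpace ℝ (Fin n)) :
    EuclideanSpace ℝ (Fin n) →ₗ[ℝ] EuclideanSpace ℝ (Fin k) :=
  ∑ i, (innerₛₗ ℝ (x i)).smulRight (EuclideanSpace.single i (1 : ℝ))

end

/-!
The proof is a small-ball argument. If `x ∈ ker Γ ∩ K` has `‖x‖ ≥ ρ`, then by convexity the multiple
of `x` of norm `ρ` lies in `T = K ∩ ρ S^{n-1}` and in `ker Γ`, so it is enough to show that `ker Γ`
misses `T` with probability `1 - δ` whenever `γ₂(T, ψ₂)` is below a small multiple of `ρ √k`.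
As both weights are at least `1`, every radius admitted in `qStar` has this property once `c` is
large; the logarithmic and linear factors are not needed.

Let `φ = truncAbs ρ` be the truncated modulus `min (2 |s| / ρ) 1`. If `t ∈ T ∩ ker Γ`, then
`∑ i, φ ⟨t, X i⟩ = 0`. On the other hand `𝔼 φ ⟨t, X⟩ ≥ 1 / 20` for every `t ∈ T`
(`one_div_twenty_le_integral_truncAbs`): this is where log-concavity enters, because by Borell's
inequality a slab of measure close to `1` and half-width `ρ / 2` would force the second moment of
`⟨t, X⟩` below `ρ ^ 2` (`one_div_twenty_le_measureReal_slab_compl`). Hence the centred process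
`truncDeviation`, which sums `φ ⟨t, X i⟩ - 𝔼 φ ⟨t, X⟩` over `i`, is at most `-k / 20` at `t`.

This is excluded by generic chaining. As `φ` is bounded and `2 / ρ`-Lipschitz, the increments of
the process are sums of independent centred variables whose `ψ₂` norm is controlled by the `ψ₂`
distance, and they have a Gaussian tail (`measure_truncDeviation_increment_le`, from
`hasSubgaussianMGF_sub_integral`). A union bound over the links of an almost optimal admissible
sequence (`measure_iUnion_links_le`) shows that, outside an event of probability `δ`, the process
is at least `-3 k / 125` along every chain, and by continuity at `t`; the chains start at the
origin, where the process vanishes, the first link being bounded by the symmetry of `T`. Isotropy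
gives convergence of the chains to `t` in the Euclidean norm (`ofReal_norm_sub_le_psiDist_two`).
-/

/-! ### The `ψ₂` norm -/

theorem psiNorm_two_lt_iff {Ω : Type*} [MeasurableSpace Ω] {P : Measure Ω} {Y : Ω → ℝ} {b : ℝ≥0∞} :
    psiNorm 2 P Y < b ↔ ∃ u : ℝ, 0 < u ∧
      ∫⁻ ω, ENNReal.ofReal (Real.exp (Y ω ^ 2 / u ^ 2)) ∂P ≤ 2 ∧ ENNReal.ofReal u < b := by
  simp only [psiNorm, iInf_lt_iff, Real.rpow_two, sq_abs, exists_prop]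

theorem psiNorm_two_mono {Ω : Type*} [MeasurableSpace Ω] {P : Measure Ω} {Y Z : Ω → ℝ}
    (h : ∀ ω, |Y ω| ≤ |Z ω|) : psiNorm 2 P Y ≤ psiNorm 2 P Z := by
  refine le_of_forall_gt fun b hb => ?_
  obtain ⟨u, hu, hZ, hub⟩ := psiNorm_two_lt_iff.1 hb
  refine psiNorm_two_lt_iff.2 ⟨u, hu, (lintegral_mono fun ω => ?_).trans hZ, hub⟩
  have := sq_le_sq.2 (h ω)
  gcongr

/-- The convexity of `x ↦ exp (x ^ 2)`, in the form that yields the triangle inequality for the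
`ψ₂` norm. -/
theorem exp_sq_add_div_le {u v : ℝ} (hu : 0 < u) (hv : 0 < v) (a b : ℝ) :
    Real.exp ((a + b) ^ 2 / (u + v) ^ 2) ≤
      u / (u + v) * Real.exp (a ^ 2 / u ^ 2) + v / (u + v) * Real.exp (b ^ 2 / v ^ 2) := by
  have huv : 0 < u + v := by positivity
  have h1 : (a + b) ^ 2 / (u + v) ^ 2 ≤
      u / (u + v) * (a ^ 2 / u ^ 2) + v / (u + v) * (b ^ 2 / v ^ 2) := by
    have : u / (u + v) * (a ^ 2 / u ^ 2) + v / (u + v) * (b ^ 2 / v ^ 2) -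
        (a + b) ^ 2 / (u + v) ^ 2 = (a * v - b * u) ^ 2 / (u * v * (u + v) ^ 2) := by
      field_simp
      ring
    have h2 : 0 ≤ (a * v - b * u) ^ 2 / (u * v * (u + v) ^ 2) := by positivity
    linarith
  refine (Real.exp_le_exp.2 h1).trans ?_
  have := convexOn_exp.2 (Set.mem_univ (a ^ 2 / u ^ 2)) (Set.mem_univ (b ^ 2 / v ^ 2))
    (div_nonneg hu.le huv.le) (div_nonneg hv.le huv.le) (by field_simp)
  simpa only [smul_eq_mul] using this

theorem psiNorm_two_add_le {Ω : Type*} [MeasurableSpace Ω] {P : Measure Ω} {Y Z : Ω → ℝ}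
    (hY : Measurable Y) :
    psiNorm 2 P (fun ω => Y ω + Z ω) ≤ psiNorm 2 P Y + psiNorm 2 P Z := by
  refine ENNReal.le_of_forall_pos_le_add fun ε hε hfin => ?_
  rw [ENNReal.add_lt_top] at hfin
  have hε2 : (ε / 2 : ℝ≥0∞) ≠ 0 := by simp [hε.ne']
  obtain ⟨u, hu, hYu, hub⟩ := psiNorm_two_lt_iff.1 (ENNReal.lt_add_right hfin.1.ne hε2)
  obtain ⟨v, hv, hZv, hvb⟩ := psiNorm_two_lt_iff.1 (ENNReal.lt_add_right hfin.2.ne hε2)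
  have key : psiNorm 2 P (fun ω => Y ω + Z ω) ≤ ENNReal.ofReal (u + v) := by
    refine le_of_forall_gt fun b hb => psiNorm_two_lt_iff.2 ⟨u + v, by positivity, ?_, hb⟩
    have huv : 0 < u + v := by positivity
    calc ∫⁻ ω, ENNReal.ofReal (Real.exp ((Y ω + Z ω) ^ 2 / (u + v) ^ 2)) ∂P
        ≤ ∫⁻ ω, (ENNReal.ofReal (u / (u + v)) * ENNReal.ofReal (Real.exp (Y ω ^ 2 / u ^ 2)) +
            ENNReal.ofReal (v / (u + v)) * ENNReal.ofReal (Real.exp (Z ω ^ 2 / v ^ 2))) ∂P := by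
          refine lintegral_mono fun ω => ?_
          rw [← ENNReal.ofReal_mul (by positivity), ← ENNReal.ofReal_mul (by positivity),
            ← ENNReal.ofReal_add (by positivity) (by positivity)]
          exact ENNReal.ofReal_le_ofReal (exp_sq_add_div_le hu hv _ _)
      _ ≤ ENNReal.ofReal (u / (u + v)) * 2 + ENNReal.ofReal (v / (u + v)) * 2 := by
          rw [lintegral_add_left (by fun_prop), lintegral_const_mul' _ _ ENNReal.ofReal_ne_top,
            lintegral_const_mul' _ _ ENNReal.ofReal_ne_top]
          gcongr
      _ = 2 := by
          rw [← add_mul, ← ENNReal.ofReal_add (by positivity) (by positivity), ← add_div,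
            div_self huv.ne', ENNReal.ofReal_one, one_mul]
  calc psiNorm 2 P (fun ω => Y ω + Z ω) ≤ ENNReal.ofReal (u + v) := key
    _ = ENNReal.ofReal u + ENNReal.ofReal v := ENNReal.ofReal_add hu.le hv.le
    _ ≤ (psiNorm 2 P Y + ε / 2) + (psiNorm 2 P Z + ε / 2) := add_le_add hub.le hvb.le
    _ = psiNorm 2 P Y + psiNorm 2 P Z + ε := by
      rw [add_add_add_comm, ENNReal.add_halves]

theorem psiDist_two_comm {n : ℕ} (μ : Measure (EuclideanSpace ℝ (Fin n)))
    (s t : EuclideanSpace ℝ (Fin n)) : psiDist 2 μ s t = psiDist 2 μ t s :=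
  le_antisymm (psiNorm_two_mono fun _ => (abs_sub_comm _ _).le)
    (psiNorm_two_mono fun _ => (abs_sub_comm _ _).le)

theorem psiDist_two_triangle {n : ℕ} (μ : Measure (EuclideanSpace ℝ (Fin n)))
    (r s t : EuclideanSpace ℝ (Fin n)) :
    psiDist 2 μ r t ≤ psiDist 2 μ r s + psiDist 2 μ s t := by
  have := psiNorm_two_add_le (P := μ) (Y := fun x => inner ℝ r x - inner ℝ s x)
    (Z := fun x => inner ℝ s x - inner ℝ t x) (by fun_prop)
  simpa only [psiDist, sub_add_sub_cancel] using this

theorem psiDist_two_zero_le {n : ℕ} (μ : Measure (EuclideanSpace ℝ (Fin n)))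
    (t : EuclideanSpace ℝ (Fin n)) : psiDist 2 μ t 0 ≤ psiDist 2 μ (-t) t := by
  refine psiNorm_two_mono fun x => ?_
  rw [inner_neg_left, inner_zero_left, sub_zero, ← neg_add', abs_neg, ← two_mul, abs_mul, abs_two]
  linarith [abs_nonneg (inner ℝ t x)]

/-- For an isotropic measure the `ψ₂` distance dominates the Euclidean one, since
`1 + 𝔼 Y ^ 2 / u ^ 2 ≤ 𝔼 exp (Y ^ 2 / u ^ 2)`. -/
theorem ofReal_norm_sub_le_psiDist_two {n : ℕ} {μ : Measure (EuclideanSpace ℝ (Fin n))}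
    [IsProbabilityMeasure μ] (hμ : IsIsotropic μ) (s t : EuclideanSpace ℝ (Fin n)) :
    ENNReal.ofReal ‖s - t‖ ≤ psiDist 2 μ s t := by
  refine le_of_forall_gt fun b hb => ?_
  obtain ⟨u, hu, hY, hub⟩ := psiNorm_two_lt_iff.1 hb
  refine lt_of_le_of_lt (ENNReal.ofReal_le_ofReal ?_) hub
  refine le_of_sq_le_sq ?_ hu.le
  have hint : Integrable (fun x => Real.exp ((inner ℝ s x - inner ℝ t x) ^ 2 / u ^ 2)) μ := by
    refine ⟨by fun_prop, ?_⟩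
    rw [hasFiniteIntegral_iff_ofReal (ae_of_all _ fun _ => (Real.exp_pos _).le)]
    exact hY.trans_lt (by simp)
  have h2 : ∫ x, Real.exp ((inner ℝ s x - inner ℝ t x) ^ 2 / u ^ 2) ∂μ ≤ 2 := by
    rw [integral_eq_lintegral_of_nonneg_ae (ae_of_all _ fun _ => (Real.exp_pos _).le)
      (by fun_prop)]
    exact ENNReal.toReal_le_of_le_ofReal (by norm_num) (by simpa using hY)
  have h3 : ∫ x, (1 + |inner ℝ x (s - t)| ^ 2 / u ^ 2) ∂μ ≤
      ∫ x, Real.exp ((inner ℝ s x - inner ℝ t x) ^ 2 / u ^ 2) ∂μ := by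
    refine integral_mono_of_nonneg (ae_of_all _ fun _ => by positivity) hint
      (ae_of_all _ fun x => ?_)
    simp only [sq_abs]
    rw [real_inner_comm, inner_sub_left, add_comm]
    exact Real.add_one_le_exp _
  have h4 : Integrable (fun x => |inner ℝ x (s - t)| ^ 2 / u ^ 2) μ := by
    refine hint.mono' (by fun_prop) (ae_of_all _ fun x => ?_)
    rw [Real.norm_of_nonneg (by positivity), sq_abs, real_inner_comm, inner_sub_left]
    linarith [Real.add_one_le_exp ((inner ℝ s x - inner ℝ t x) ^ 2 / u ^ 2)]
  rw [integral_add (integrable_const _) h4, integral_div, hμ] at h3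
  simp only [integral_const, probReal_univ, smul_eq_mul, mul_one] at h3
  have h5 : ‖s - t‖ ^ 2 / u ^ 2 ≤ 1 := by linarith
  rwa [div_le_one (by positivity)] at h5

/-! ### Concentration of sums of independent `ψ₂` variables -/

theorem exp_le_add_exp_sq (x : ℝ) : Real.exp x ≤ x + Real.exp (x ^ 2) := by
  have h := Real.add_one_le_exp (x ^ 2)
  rcases le_total |x| 1 with hx | hx
  · have := (abs_le.1 (Real.abs_exp_sub_one_sub_id_le hx)).2
    linarith
  · rcases le_abs.1 hx with h1 | h1
    · have : Real.exp x ≤ Real.exp (x ^ 2) := Real.exp_le_exp.2 (by nlinarith)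
      linarith
    · have : Real.exp x ≤ 1 := Real.exp_le_one_iff.2 (by linarith)
      nlinarith

/-- Jensen's inequality for `y ↦ y ^ θ`, applied to `exp y` and linearised. -/
theorem integral_exp_mul_le {Ω : Type*} [MeasurableSpace Ω] {μ : Measure Ω}
    [IsProbabilityMeasure μ] {Y : Ω → ℝ} (hY : Integrable (fun ω => Real.exp (Y ω)) μ)
    (h2 : ∫ ω, Real.exp (Y ω) ∂μ ≤ 2) {θ : ℝ} (h0 : 0 ≤ θ) (h1 : θ ≤ 1) :
    ∫ ω, Real.exp (θ * Y ω) ∂μ ≤ Real.exp θ := by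
  have h3 : ∫ ω, Real.exp (θ * Y ω) ∂μ ≤ ∫ ω, ((1 - θ) + θ * Real.exp (Y ω)) ∂μ := by
    refine integral_mono_of_nonneg (ae_of_all _ fun _ => (Real.exp_pos _).le)
      ((integrable_const _).add (hY.const_mul _)) (ae_of_all _ fun ω => ?_)
    have := convexOn_exp.2 (Set.mem_univ 0) (Set.mem_univ (Y ω)) (sub_nonneg.2 h1) h0 (by ring)
    simpa using this
  rw [integral_add (integrable_const _) (hY.const_mul _), integral_const_mul] at h3
  simp only [integral_const, probReal_univ, smul_eq_mul, one_mul] at h3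
  nlinarith [Real.add_one_le_exp θ]

/-- A bounded variable with `ψ₂` norm at most `v` is sub-Gaussian after centring, with a variance
proxy that depends on `v` only and not on the bound. -/
theorem hasSubgaussianMGF_sub_integral {Ω : Type*} [MeasurableSpace Ω] {μ : Measure Ω}
    [IsProbabilityMeasure μ] {f : Ω → ℝ} (hf : Measurable f) {B : ℝ} (hB : ∀ ω, |f ω| ≤ B)
    {v : ℝ} (hv : 0 < v)
    (h2 : ∫⁻ ω, ENNReal.ofReal (Real.exp (f ω ^ 2 / v ^ 2)) ∂μ ≤ 2) :
    HasSubgaussianMGF (fun ω => f ω - ∫ x, f x ∂μ) (Real.toNNReal (8 * v ^ 2)) μ := by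
  set m := ∫ x, f x ∂μ with hm
  have hbdd : ∀ g : ℝ → ℝ, Continuous g → Integrable (fun ω => g (f ω)) μ := fun g hg => by
    obtain ⟨C, hC⟩ := (isCompact_Icc (a := -B) (b := B)).exists_bound_of_continuousOn
      hg.continuousOn
    exact Integrable.of_bound (hg.measurable.comp hf).aestronglyMeasurable C
      (ae_of_all _ fun ω => hC _ (abs_le.1 (hB ω)))
  have hexp : Integrable (fun ω => Real.exp (f ω ^ 2 / v ^ 2)) μ :=
    hbdd (fun y => Real.exp (y ^ 2 / v ^ 2)) (by fun_prop)
  have h2' : ∫ ω, Real.exp (f ω ^ 2 / v ^ 2) ∂μ ≤ 2 := by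
    rw [integral_eq_lintegral_of_nonneg_ae (ae_of_all _ fun _ => (Real.exp_pos _).le)
      (by fun_prop)]
    exact ENNReal.toReal_le_of_le_ofReal (by norm_num) (by simpa using h2)
  have hm2 : m ^ 2 ≤ v ^ 2 := by
    have hvar : m ^ 2 ≤ ∫ ω, f ω ^ 2 ∂μ := by
      have h0 : 0 ≤ ∫ ω, (f ω - m) ^ 2 ∂μ := integral_nonneg fun _ => sq_nonneg _
      have h1 : ∫ ω, (f ω - m) ^ 2 ∂μ = ∫ ω, (f ω ^ 2 + (-(2 * m) * f ω + m ^ 2)) ∂μ := by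
        congr 1 with ω
        ring
      rw [h1, integral_add (hbdd (fun y => y ^ 2) (by fun_prop))
        (hbdd (fun y => -(2 * m) * y + m ^ 2) (by fun_prop)),
        integral_add (hbdd (fun y => -(2 * m) * y) (by fun_prop)) (integrable_const _),
        integral_const_mul, ← hm] at h0
      simp only [integral_const, probReal_univ, smul_eq_mul, one_mul] at h0
      nlinarith
    have h1 : ∫ ω, (f ω ^ 2 / v ^ 2 + 1) ∂μ ≤ ∫ ω, Real.exp (f ω ^ 2 / v ^ 2) ∂μ :=
      integral_mono (hbdd (fun y => y ^ 2 / v ^ 2 + 1) (by fun_prop)) hexp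
        fun ω => Real.add_one_le_exp _
    rw [integral_add (hbdd (fun y => y ^ 2 / v ^ 2) (by fun_prop)) (integrable_const _),
      integral_div] at h1
    simp only [integral_const, probReal_univ, smul_eq_mul, one_mul] at h1
    have h3 : (∫ ω, f ω ^ 2 ∂μ) / v ^ 2 ≤ 1 := by linarith
    rw [div_le_one (by positivity)] at h3
    exact hvar.trans h3
  have hsq : ∀ ω, (f ω - m) ^ 2 ≤ 2 * f ω ^ 2 + 2 * v ^ 2 := fun ω => by
    nlinarith [sq_nonneg (f ω + m)]
  refine ⟨fun t => hbdd (fun y => Real.exp (t * (y - m))) (by fun_prop), fun t => ?_⟩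
  have hcoe : ((Real.toNNReal (8 * v ^ 2) : NNReal) : ℝ) * t ^ 2 / 2 = 4 * (t ^ 2 * v ^ 2) := by
    rw [Real.coe_toNNReal _ (by positivity)]
    ring
  rw [hcoe, mgf]
  -- For small `t` use `exp x ≤ x + exp (x ^ 2)`, whose linear term integrates to zero; for large
  -- `t` the inequality `t y ≤ t² v² + y² / (4 v²)` suffices.
  rcases le_total (t ^ 2 * v ^ 2) (1 / 2) with ht | ht
  · calc ∫ ω, Real.exp (t * (f ω - m)) ∂μ
        ≤ ∫ ω, (t * (f ω - m) + Real.exp (2 * (t ^ 2 * v ^ 2)) *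
            Real.exp (2 * (t ^ 2 * v ^ 2) * (f ω ^ 2 / v ^ 2))) ∂μ := by
          refine integral_mono (hbdd (fun y => Real.exp (t * (y - m))) (by fun_prop))
            (hbdd (fun y => t * (y - m) + Real.exp (2 * (t ^ 2 * v ^ 2)) *
              Real.exp (2 * (t ^ 2 * v ^ 2) * (y ^ 2 / v ^ 2))) (by fun_prop)) fun ω => ?_
          refine (exp_le_add_exp_sq _).trans ?_
          rw [← Real.exp_add]
          gcongr
          have : 2 * (t ^ 2 * v ^ 2) * (f ω ^ 2 / v ^ 2) = 2 * t ^ 2 * f ω ^ 2 := by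
            field_simp
          rw [this]
          nlinarith [mul_le_mul_of_nonneg_left (hsq ω) (sq_nonneg t)]
      _ = Real.exp (2 * (t ^ 2 * v ^ 2)) *
            ∫ ω, Real.exp (2 * (t ^ 2 * v ^ 2) * (f ω ^ 2 / v ^ 2)) ∂μ := by
          rw [integral_add (hbdd (fun y => t * (y - m)) (by fun_prop))
            (hbdd (fun y => Real.exp (2 * (t ^ 2 * v ^ 2)) *
              Real.exp (2 * (t ^ 2 * v ^ 2) * (y ^ 2 / v ^ 2))) (by fun_prop)),
            integral_const_mul, integral_const_mul,
            integral_sub (hbdd (fun y => y) continuous_id) (integrable_const _)]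
          simp [hm]
      _ ≤ Real.exp (2 * (t ^ 2 * v ^ 2)) * Real.exp (2 * (t ^ 2 * v ^ 2)) := by
          gcongr
          exact integral_exp_mul_le hexp h2' (by positivity) (by linarith)
      _ = Real.exp (4 * (t ^ 2 * v ^ 2)) := by
          rw [← Real.exp_add]
          ring_nf
  · calc ∫ ω, Real.exp (t * (f ω - m)) ∂μ
        ≤ ∫ ω, Real.exp (t ^ 2 * v ^ 2 + 1 / 2) * Real.exp (1 / 2 * (f ω ^ 2 / v ^ 2)) ∂μ := by
          refine integral_mono (hbdd (fun y => Real.exp (t * (y - m))) (by fun_prop))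
            (hbdd (fun y => Real.exp (t ^ 2 * v ^ 2 + 1 / 2) *
              Real.exp (1 / 2 * (y ^ 2 / v ^ 2))) (by fun_prop)) fun ω => ?_
          beta_reduce
          rw [← Real.exp_add]
          gcongr
          have h3 : (f ω - m) ^ 2 / (4 * v ^ 2) ≤ 1 / 2 * (f ω ^ 2 / v ^ 2) + 1 / 2 := by
            rw [div_le_iff₀ (by positivity)]
            have : (1 / 2 * (f ω ^ 2 / v ^ 2) + 1 / 2) * (4 * v ^ 2) =
              2 * f ω ^ 2 + 2 * v ^ 2 := by
              field_simp
              ring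
            rw [this]
            exact hsq ω
          have h4 : t ^ 2 * v ^ 2 + (f ω - m) ^ 2 / (4 * v ^ 2) - t * (f ω - m) =
              (t * v - (f ω - m) / (2 * v)) ^ 2 := by
            field_simp
            ring
          nlinarith [sq_nonneg (t * v - (f ω - m) / (2 * v))]
      _ ≤ Real.exp (t ^ 2 * v ^ 2 + 1 / 2) * Real.exp (1 / 2) := by
          rw [integral_const_mul]
          gcongr
          exact integral_exp_mul_le hexp h2' (by norm_num) (by norm_num)
      _ ≤ Real.exp (4 * (t ^ 2 * v ^ 2)) := by
          rw [← Real.exp_add]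
          gcongr
          linarith

theorem measure_sum_sub_integral_ge_le {E Ω : Type*} [MeasurableSpace E] [MeasurableSpace Ω]
    {μ : Measure E} [IsProbabilityMeasure μ] {P : Measure Ω} {k : ℕ}
    {X : Fin k → Ω → E} (hX : ∀ i, HasLaw (X i) μ P) (hind : iIndepFun X P)
    {f : E → ℝ} (hf : Measurable f) {B : ℝ} (hB : ∀ x, |f x| ≤ B)
    {v : ℝ} (hv : 0 < v) (h2 : ∫⁻ x, ENNReal.ofReal (Real.exp (f x ^ 2 / v ^ 2)) ∂μ ≤ 2)
    {ε : ℝ} (hε : 0 ≤ ε) :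
    P {ω | ε ≤ ∑ i, (f (X i ω) - ∫ x, f x ∂μ)} ≤
      ENNReal.ofReal (Real.exp (-ε ^ 2 / (16 * k * v ^ 2))) := by
  have hprob : IsProbabilityMeasure P := hind.isProbabilityMeasure
  have hsub : ∀ i, HasSubgaussianMGF (fun ω => f (X i ω) - ∫ x, f x ∂μ)
      (Real.toNNReal (8 * v ^ 2)) P := fun i => by
    have h := hasSubgaussianMGF_sub_integral hf hB hv h2
    rw [← (hX i).map_eq] at h
    have h' := h.of_map (hX i).aemeasurable
    rwa [(hX i).map_eq] at h'
  have hi : iIndepFun (fun i ω => f (X i ω) - ∫ x, f x ∂μ) P :=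
    hind.comp (fun _ x => f x - ∫ x, f x ∂μ) fun _ => hf.sub_const _
  have h := HasSubgaussianMGF.measure_sum_ge_le_of_iIndepFun hi
    (s := Finset.univ) (fun i _ => hsub i) hε
  rw [← ofReal_measureReal]
  refine ENNReal.ofReal_le_ofReal (h.trans_eq ?_)
  simp only [Finset.sum_const, Finset.card_univ, Fintype.card_fin, nsmul_eq_mul, NNReal.coe_mul,
    NNReal.coe_natCast, Real.coe_toNNReal _ (show 0 ≤ 8 * v ^ 2 by positivity)]
  ring_nf

/-! ### A small-ball estimate for log-concave measures -/

/-- Borell's inequality with dilation factor `3`: the midpoint of a point outside `3 A` and a point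
of the symmetric slab `A` lies outside `A`. -/
theorem measureReal_slab_compl_mul_le {n : ℕ} {μ : Measure (EuclideanSpace ℝ (Fin n))}
    [IsProbabilityMeasure μ] (hμ : IsLogConcaveMeasure μ) (y : EuclideanSpace ℝ (Fin n)) (r : ℝ) :
    μ.real {x | 3 * r < |inner ℝ x y|} * (1 - μ.real {x | r < |inner ℝ x y|}) ≤
      μ.real {x | r < |inner ℝ x y|} ^ 2 := by
  have hm : ∀ s : ℝ, MeasurableSet {x : EuclideanSpace ℝ (Fin n) | s < |inner ℝ x y|} := fun s =>
    measurableSet_lt measurable_const (by fun_prop)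
  have hcompl : 1 - μ.real {x | r < |inner ℝ x y|} = μ.real {x | r < |inner ℝ x y|}ᶜ := by
    rw [probReal_compl_eq_one_sub (hm r)]
  have h := hμ (1 / 2) (by norm_num) (by norm_num) _ _ (hm (3 * r)) (hm r).compl
  have hsub : (1 / 2 : ℝ) • {x : EuclideanSpace ℝ (Fin n) | 3 * r < |inner ℝ x y|} +
      (1 - 1 / 2 : ℝ) • {x : EuclideanSpace ℝ (Fin n) | r < |inner ℝ x y|}ᶜ ⊆
      {x | r < |inner ℝ x y|} := by
    rintro _ ⟨_, ⟨a, ha, rfl⟩, _, ⟨b, hb, rfl⟩, rfl⟩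
    simp only [Set.mem_ofPred_eq, Set.mem_compl_iff, not_lt] at ha hb ⊢
    simp only [inner_add_left, real_inner_smul_left]
    have h1 := abs_sub_abs_le_abs_add (1 / 2 * inner ℝ a y) ((1 - 1 / 2) * inner ℝ b y)
    rw [abs_mul, abs_mul] at h1
    norm_num at h1 ⊢
    linarith
  have h2 := h.trans (measure_mono hsub)
  rw [show (1 - 1 / 2 : ℝ) = 1 / 2 by norm_num, ← ENNReal.mul_rpow_of_nonneg _ _ (by norm_num),
    one_div, ENNReal.rpow_inv_le_iff (by norm_num), ENNReal.rpow_two] at h2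
  rw [hcompl]
  simpa only [measureReal_def, ENNReal.toReal_mul, ENNReal.toReal_pow] using
    ENNReal.toReal_mono (by finiteness) h2

/-- A layer-cake bound on the geometric scale `3 ^ j * r`. -/
theorem ofReal_sq_le_add_tsum {r : ℝ} (hr : 0 < r) (y : ℝ) :
    ENNReal.ofReal (y ^ 2) ≤ ENNReal.ofReal (r ^ 2) +
      ∑' j : ℕ, ENNReal.ofReal (9 ^ (j + 1) * r ^ 2) *
        {z : ℝ | 3 ^ j * r < |z|}.indicator (fun _ => (1 : ℝ≥0∞)) y := by
  have hex : ∃ m : ℕ, |y| ≤ 3 ^ m * r := by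
    obtain ⟨m, hm⟩ := pow_unbounded_of_one_lt (|y| / r) (show (1 : ℝ) < 3 by norm_num)
    exact ⟨m, ((div_lt_iff₀ hr).1 hm).le⟩
  classical
  obtain ⟨m, hm, hmin⟩ : ∃ m : ℕ, |y| ≤ 3 ^ m * r ∧ ∀ j < m, 3 ^ j * r < |y| :=
    ⟨Nat.find hex, Nat.find_spec hex, fun j hj => not_le.1 (Nat.find_min hex hj)⟩
  have hsq : y ^ 2 ≤ 9 ^ m * r ^ 2 := by
    have h := pow_le_pow_left₀ (abs_nonneg y) hm 2
    rwa [sq_abs, mul_pow, ← pow_mul, mul_comm m 2, pow_mul, show (3 : ℝ) ^ 2 = 9 by norm_num] at h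
  cases m with
  | zero => exact le_add_right (ENNReal.ofReal_le_ofReal (by simpa using hsq))
  | succ j =>
    refine le_add_left (le_trans ?_ (ENNReal.le_tsum j))
    rw [Set.indicator_of_mem (show y ∈ {z : ℝ | 3 ^ j * r < |z|} from hmin j (by omega)), mul_one]
    exact ENNReal.ofReal_le_ofReal hsq

/-- Linear functionals have a uniform small-ball property: if a slab of half-width `‖y‖ / 2` had
measure above `19 / 20`, the tails given by `measureReal_slab_compl_mul_le` would decay too fast for
the second moment to reach `‖y‖ ^ 2`. -/
theorem one_div_twenty_le_measureReal_slab_compl {n : ℕ} {μ : Measure (EuclideanSpace ℝ (Fin n))}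
    [IsProbabilityMeasure μ] (hiso : IsIsotropic μ) (hμ : IsLogConcaveMeasure μ)
    {y : EuclideanSpace ℝ (Fin n)} (hy : 0 < ‖y‖) :
    1 / 20 ≤ μ.real {x | ‖y‖ / 2 < |inner ℝ x y|} := by
  by_contra! hlt
  set r := ‖y‖ / 2 with hr
  have hr0 : 0 < r := by positivity
  have hdecay : ∀ j : ℕ, μ.real {x | 3 ^ j * r < |inner ℝ x y|} ≤ 1 / 20 * (1 / 19) ^ j := by
    intro j
    induction j with
    | zero => simpa using hlt.le
    | succ j ih =>
      have h := measureReal_slab_compl_mul_le hμ y (3 ^ j * r)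
      rw [← mul_assoc, ← pow_succ'] at h
      have h1 : (1 / 20 : ℝ) * (1 / 19) ^ j ≤ 1 / 20 :=
        mul_le_of_le_one_right (by norm_num) (pow_le_one₀ (by norm_num) (by norm_num))
      have h0 : 0 ≤ μ.real {x | 3 ^ j * r < |inner ℝ x y|} := measureReal_nonneg
      have h2 : 0 ≤ μ.real {x | 3 ^ (j + 1) * r < |inner ℝ x y|} := measureReal_nonneg
      have h3 : μ.real {x | 3 ^ j * r < |inner ℝ x y|} ^ 2 ≤
          1 / 20 * μ.real {x | 3 ^ j * r < |inner ℝ x y|} := by nlinarith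
      have h4 : 19 / 20 * μ.real {x | 3 ^ (j + 1) * r < |inner ℝ x y|} ≤
          μ.real {x | 3 ^ (j + 1) * r < |inner ℝ x y|} *
            (1 - μ.real {x | 3 ^ j * r < |inner ℝ x y|}) := by nlinarith
      rw [pow_succ (1 / 19 : ℝ)]
      linarith
  have hint : Integrable (fun x => |inner ℝ x y| ^ 2) μ := by
    by_contra hni
    have h := hiso y
    rw [integral_undef hni] at h
    exact (pow_pos hy 2).ne h
  have hm : ∀ j : ℕ, MeasurableSet {x : EuclideanSpace ℝ (Fin n) | 3 ^ j * r < |inner ℝ x y|} :=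
    fun j => measurableSet_lt measurable_const (by fun_prop)
  have hsum : HasSum (fun j : ℕ => 9 / 20 * r ^ 2 * (9 / 19) ^ j)
      (9 / 20 * r ^ 2 * (1 - 9 / 19)⁻¹) :=
    (hasSum_geometric_of_lt_one (by norm_num) (by norm_num)).mul_left _
  have hupper : ENNReal.ofReal (‖y‖ ^ 2) ≤
      ENNReal.ofReal (r ^ 2 + 9 / 20 * r ^ 2 * (1 - 9 / 19)⁻¹) := by
    calc ENNReal.ofReal (‖y‖ ^ 2)
        = ∫⁻ x, ENNReal.ofReal (|inner ℝ x y| ^ 2) ∂μ := by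
          rw [← hiso y, ofReal_integral_eq_lintegral_ofReal hint
            (ae_of_all _ fun _ => by positivity)]
      _ ≤ ∫⁻ x, (ENNReal.ofReal (r ^ 2) + ∑' j : ℕ, ENNReal.ofReal (9 ^ (j + 1) * r ^ 2) *
            {x | 3 ^ j * r < |inner ℝ x y|}.indicator (fun _ => (1 : ℝ≥0∞)) x) ∂μ := by
          refine lintegral_mono fun x => ?_
          rw [sq_abs]
          exact ofReal_sq_le_add_tsum hr0 _
      _ = ENNReal.ofReal (r ^ 2) + ∑' j : ℕ, ENNReal.ofReal (9 ^ (j + 1) * r ^ 2) *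
            μ {x | 3 ^ j * r < |inner ℝ x y|} := by
          rw [lintegral_add_left measurable_const, lintegral_tsum fun j =>
            ((measurable_const.indicator (hm j)).const_mul _).aemeasurable]
          simp only [lintegral_const, measure_univ, mul_one]
          congr 2 with j
          rw [lintegral_const_mul _ (measurable_const.indicator (hm j)),
            lintegral_indicator_const (hm j), one_mul]
      _ ≤ ENNReal.ofReal (r ^ 2) + ∑' j : ℕ, ENNReal.ofReal (9 / 20 * r ^ 2 * (9 / 19) ^ j) := by
          gcongr with j
          rw [← ofReal_measureReal, ← ENNReal.ofReal_mul (by positivity)]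
          refine ENNReal.ofReal_le_ofReal
            ((mul_le_mul_of_nonneg_left (hdecay j) (by positivity)).trans_eq ?_)
          rw [pow_succ, show (9 / 19 : ℝ) = 9 * (1 / 19) by norm_num, mul_pow]
          ring
      _ = ENNReal.ofReal (r ^ 2 + 9 / 20 * r ^ 2 * (1 - 9 / 19)⁻¹) := by
          rw [← ENNReal.ofReal_tsum_of_nonneg (fun _ => by positivity) hsum.summable,
            hsum.tsum_eq, ENNReal.ofReal_add (by positivity) (by positivity)]
  rw [ENNReal.ofReal_le_ofReal_iff (by positivity), hr] at hupper
  nlinarith [pow_pos hy 2]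

/-! ### Generic chaining -/

theorem IsAdmissibleSeq.exists_finset {M : Type*} {T : Set M} {S : ℕ → Set M}
    (hS : IsAdmissibleSeq T S) (s : ℕ) : ∃ F : Finset M, ↑F = S s ∧ F.card ≤ 2 ^ 2 ^ s := by
  have h : (S s).encard ≤ ((2 ^ 2 ^ s : ℕ) : ℕ∞) := by
    cases s with
    | zero => exact hS.card_zero.trans (by norm_num)
    | succ s => exact (hS.card_le _ (by omega)).trans (by push_cast; exact le_rfl)
  have hfin := Set.finite_of_encard_le_coe h
  refine ⟨hfin.toFinset, hfin.coe_toFinset, ?_⟩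
  rwa [hfin.encard_eq_coe_toFinset_card, Nat.cast_le] at h

theorem talagrandGamma_empty {M : Type*} (β : ℝ) (d : M → M → ℝ≥0∞) :
    talagrandGamma β d ∅ = 0 := by
  have hS : IsAdmissibleSeq (∅ : Set M) fun _ => ∅ :=
    ⟨fun _ => subset_rfl, by simp, fun _ _ => by simp⟩
  refine le_antisymm ((iInf₂_le _ hS).trans ?_) bot_le
  simp

/-- The union bound over all links of a chain: there are at most `8 ^ 2 ^ s` links between the
levels `s` and `s + 1`. -/
theorem measure_iUnion_links_le {M Ω : Type*} [MeasurableSpace Ω] {P : Measure Ω} {T : Set M}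
    {S : ℕ → Set M} (hS : IsAdmissibleSeq T S) {q : ℝ} (hq0 : 0 ≤ q) (hq : q ≤ 1 / 2)
    (E : ℕ → M → M → Set Ω) (hE : ∀ s a b, P (E s a b) ≤ ENNReal.ofReal ((q / 8) ^ 2 ^ s)) :
    P (⋃ s, ⋃ a ∈ S (s + 1), ⋃ b ∈ S s, E s a b) ≤ ENNReal.ofReal (2 * q) := by
  have hlevel : ∀ s, P (⋃ a ∈ S (s + 1), ⋃ b ∈ S s, E s a b) ≤
      ENNReal.ofReal (q * (1 / 2) ^ s) := by
    intro s
    obtain ⟨F, hF, hFc⟩ := hS.exists_finset (s + 1)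
    obtain ⟨G, hG, hGc⟩ := hS.exists_finset s
    have hcard : F.card * G.card ≤ 8 ^ 2 ^ s := by
      refine (Nat.mul_le_mul hFc hGc).trans_eq ?_
      rw [pow_succ 2 s, mul_comm _ 2, pow_mul, ← mul_pow]
      norm_num
    simp only [← hF, ← hG, Finset.mem_coe]
    calc P (⋃ a ∈ F, ⋃ b ∈ G, E s a b)
        ≤ ∑ a ∈ F, ∑ b ∈ G, P (E s a b) :=
          (measure_biUnion_finset_le _ _).trans
            (Finset.sum_le_sum fun _ _ => measure_biUnion_finset_le _ _)
      _ ≤ ∑ a ∈ F, ∑ b ∈ G, ENNReal.ofReal ((q / 8) ^ 2 ^ s) := by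
          gcongr
          exact hE _ _ _
      _ = ((F.card * G.card : ℕ) : ℝ≥0∞) * ENNReal.ofReal ((q / 8) ^ 2 ^ s) := by
          simp [mul_assoc]
      _ ≤ ((8 ^ 2 ^ s : ℕ) : ℝ≥0∞) * ENNReal.ofReal ((q / 8) ^ 2 ^ s) := by
          gcongr
      _ = ENNReal.ofReal (q ^ 2 ^ s) := by
          rw [← ENNReal.ofReal_natCast, ← ENNReal.ofReal_mul (by positivity)]
          push_cast
          rw [← mul_pow, mul_div_cancel₀ _ (by norm_num)]
      _ ≤ ENNReal.ofReal (q * (1 / 2) ^ s) := by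
          refine ENNReal.ofReal_le_ofReal ?_
          calc q ^ 2 ^ s ≤ q ^ (s + 1) :=
                pow_le_pow_of_le_one hq0 (by linarith) Nat.lt_two_pow_self
            _ = q * q ^ s := pow_succ' _ _
            _ ≤ q * (1 / 2) ^ s := by gcongr
  refine (measure_iUnion_le _).trans ((ENNReal.tsum_le_tsum hlevel).trans_eq ?_)
  rw [← ENNReal.ofReal_tsum_of_nonneg (fun _ => by positivity)
    (summable_geometric_two.mul_left q), tsum_mul_left, tsum_geometric_two, mul_comm]

/-- Along an admissible sequence the infima in `talagrandGamma` are attained, since the levels are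
finite, and non-empty as soon as the series converges. -/
theorem exists_chain {M : Type*} {T : Set M} {S : ℕ → Set M} (hS : IsAdmissibleSeq T S)
    {d : M → M → ℝ≥0∞} {W : ℝ≥0∞} (hW : W ≠ ∞) {t : M}
    (ht : ∑' s : ℕ, (2 : ℝ≥0∞) ^ ((s : ℝ) / 2) * ⨅ a ∈ S s, d t a ≤ W) :
    ∃ π : ℕ → M, (∀ s, π s ∈ S s) ∧ ∑' s : ℕ, (2 : ℝ≥0∞) ^ ((s : ℝ) / 2) * d t (π s) ≤ W := by
  have hmin : ∀ s, ∃ a ∈ S s, ∀ b ∈ S s, d t a ≤ d t b := by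
    intro s
    obtain ⟨F, hF, -⟩ := hS.exists_finset s
    refine Set.exists_min_image (S s) (d t) (hF ▸ F.finite_toSet) ?_
    by_contra hemp
    rw [Set.not_nonempty_iff_eq_empty] at hemp
    have h := (ENNReal.le_tsum s).trans ht
    rw [hemp] at h
    simp only [Set.mem_empty_iff_false, iInf_false, iInf_top] at h
    rw [ENNReal.mul_top (by simp [ENNReal.rpow_eq_zero_iff])] at h
    exact hW (top_le_iff.1 h)
  choose π hπ hle using hmin
  refine ⟨π, hπ, (ENNReal.tsum_le_tsum fun s => ?_).trans ht⟩
  gcongr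
  exact le_iInf₂ (hle s)

/-- If a function decreases along each link of a chain by no more than `κ` times the weighted length
of the link, its total decrease is controlled by the chaining functional. -/
theorem ofReal_sub_le_of_chain {M : Type*} {d : M → M → ℝ≥0∞} (hsymm : ∀ a b, d a b = d b a)
    (htri : ∀ a b c, d a c ≤ d a b + d b c) {W : ℝ≥0∞} {t : M} {π : ℕ → M}
    (hπ : ∑' s : ℕ, (2 : ℝ≥0∞) ^ ((s : ℝ) / 2) * d t (π s) ≤ W) {κ : ℝ≥0∞} {g : M → ℝ}
    (hg : ∀ s : ℕ, ENNReal.ofReal (g (π s) - g (π (s + 1))) ≤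
      κ * ((2 : ℝ≥0∞) ^ ((s : ℝ) / 2) * d (π (s + 1)) (π s))) (m : ℕ) :
    ENNReal.ofReal (g (π 0) - g (π m)) ≤ κ * (W + W) := by
  have hstep : ∀ s : ℕ, (2 : ℝ≥0∞) ^ ((s : ℝ) / 2) * d (π (s + 1)) (π s) ≤
      (2 : ℝ≥0∞) ^ (((s + 1 : ℕ) : ℝ) / 2) * d t (π (s + 1)) +
        (2 : ℝ≥0∞) ^ ((s : ℝ) / 2) * d t (π s) := by
    intro s
    calc (2 : ℝ≥0∞) ^ ((s : ℝ) / 2) * d (π (s + 1)) (π s)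
        ≤ (2 : ℝ≥0∞) ^ ((s : ℝ) / 2) * (d t (π (s + 1)) + d t (π s)) := by
          gcongr
          rw [hsymm t (π (s + 1))]
          exact htri _ _ _
      _ ≤ _ := by
          rw [mul_add]
          gcongr
          · norm_num
          · omega
  have hpartial : ENNReal.ofReal (g (π 0) - g (π m)) ≤
      κ * ∑ s ∈ Finset.range m, (2 : ℝ≥0∞) ^ ((s : ℝ) / 2) * d (π (s + 1)) (π s) := by
    induction m with
    | zero => simp
    | succ m ih =>
      rw [Finset.sum_range_succ, mul_add, ← sub_add_sub_cancel (g (π 0)) (g (π m))]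
      exact ENNReal.ofReal_add_le.trans (add_le_add ih (hg m))
  refine hpartial.trans ?_
  gcongr
  calc ∑ s ∈ Finset.range m, (2 : ℝ≥0∞) ^ ((s : ℝ) / 2) * d (π (s + 1)) (π s)
      ≤ ∑' s : ℕ, (2 : ℝ≥0∞) ^ ((s : ℝ) / 2) * d (π (s + 1)) (π s) := ENNReal.sum_le_tsum _
    _ ≤ _ := ENNReal.tsum_le_tsum hstep
    _ ≤ W + W := by
      rw [ENNReal.tsum_add]
      refine add_le_add ((ENNReal.tsum_comp_le_tsum_of_injective (add_left_injective 1)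
        fun s : ℕ => (2 : ℝ≥0∞) ^ ((s : ℝ) / 2) * d t (π s)).trans hπ) hπ

theorem tendsto_zero_of_chain {M : Type*} {d : M → M → ℝ≥0∞} {W : ℝ≥0∞} (hW : W ≠ ∞) {t : M}
    {π : ℕ → M} (hπ : ∑' s : ℕ, (2 : ℝ≥0∞) ^ ((s : ℝ) / 2) * d t (π s) ≤ W) :
    Filter.Tendsto (fun s => d t (π s)) Filter.atTop (nhds 0) := by
  refine tendsto_of_tendsto_of_tendsto_of_le_of_le tendsto_const_nhds
    (ENNReal.tendsto_atTop_zero_of_tsum_ne_top (ne_top_of_le_ne_top hW hπ))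
    (fun _ => bot_le) fun s => ?_
  have h := ENNReal.rpow_le_rpow_of_exponent_le (x := 2) one_le_two
    (show (0 : ℝ) ≤ (s : ℝ) / 2 by positivity)
  rw [ENNReal.rpow_zero] at h
  exact le_mul_of_one_le_left' h

/-! ### Kernels of sample operators avoid sections of small complexity -/

/-- The truncated modulus `min (2 |s| / ρ) 1`. It vanishes at `0`, is `2 / ρ`-Lipschitz, and equals
`1` where `|s| ≥ ρ / 2`. -/
noncomputable def truncAbs (ρ s : ℝ) : ℝ := min (2 * |s| / ρ) 1

@[fun_prop]
theorem continuous_truncAbs (ρ : ℝ) : Continuous (truncAbs ρ) := by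
  unfold truncAbs
  fun_prop

theorem truncAbs_zero (ρ : ℝ) : truncAbs ρ 0 = 0 := by
  simp [truncAbs]

theorem truncAbs_nonneg {ρ : ℝ} (hρ : 0 < ρ) (s : ℝ) : 0 ≤ truncAbs ρ s :=
  le_min (by positivity) zero_le_one

theorem abs_truncAbs_sub_le_one {ρ : ℝ} (hρ : 0 < ρ) (s t : ℝ) :
    |truncAbs ρ s - truncAbs ρ t| ≤ 1 :=
  abs_sub_le_of_nonneg_of_le (truncAbs_nonneg hρ s) (min_le_right _ _) (truncAbs_nonneg hρ t)
    (min_le_right _ _)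

theorem abs_truncAbs_sub_le {ρ : ℝ} (hρ : 0 < ρ) (s t : ℝ) :
    |truncAbs ρ s - truncAbs ρ t| ≤ 2 / ρ * |s - t| := by
  have h := abs_min_sub_min_le_max (2 * |s| / ρ) 1 (2 * |t| / ρ) 1
  rw [sub_self, abs_zero, max_eq_left (abs_nonneg _)] at h
  refine h.trans ?_
  rw [show 2 * |s| / ρ - 2 * |t| / ρ = 2 / ρ * (|s| - |t|) by ring, abs_mul,
    abs_of_pos (show 0 < 2 / ρ by positivity)]
  exact mul_le_mul_of_nonneg_left (abs_abs_sub_abs_le s t) (by positivity)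

theorem integrable_truncAbs_inner {n : ℕ} (μ : Measure (EuclideanSpace ℝ (Fin n)))
    [IsProbabilityMeasure μ] {ρ : ℝ} (hρ : 0 < ρ) (y : EuclideanSpace ℝ (Fin n)) :
    Integrable (fun x => truncAbs ρ (inner ℝ y x)) μ :=
  Integrable.of_bound (by fun_prop) 1 (ae_of_all _ fun x => by
    simpa [truncAbs_zero] using abs_truncAbs_sub_le_one hρ (inner ℝ y x) 0)

theorem one_div_twenty_le_integral_truncAbs {n : ℕ} {μ : Measure (EuclideanSpace ℝ (Fin n))}
    [IsProbabilityMeasure μ] (hiso : IsIsotropic μ) (hμ : IsLogConcaveMeasure μ) {ρ : ℝ}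
    (hρ : 0 < ρ) {y : EuclideanSpace ℝ (Fin n)} (hy : ‖y‖ = ρ) :
    1 / 20 ≤ ∫ x, truncAbs ρ (inner ℝ y x) ∂μ := by
  have hm : MeasurableSet {x : EuclideanSpace ℝ (Fin n) | ρ / 2 < |inner ℝ x y|} :=
    measurableSet_lt measurable_const (by fun_prop)
  have h := one_div_twenty_le_measureReal_slab_compl hiso hμ (hy ▸ hρ : 0 < ‖y‖)
  rw [hy] at h
  refine h.trans ?_
  rw [← integral_indicator_one hm]
  refine integral_mono ((integrable_const (1 : ℝ)).indicator hm)
    (integrable_truncAbs_inner μ hρ y) fun x => ?_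
  refine Set.indicator_le' (fun x hx => ?_) (fun x _ => truncAbs_nonneg hρ _) x
  refine le_min ?_ le_rfl
  rw [Set.mem_ofPred_eq, real_inner_comm] at hx
  rw [Pi.one_apply, le_div_iff₀ hρ]
  linarith

/-- The centred empirical process `y ↦ ∑ i, (φ ⟨y, x i⟩ - ∫ φ ⟨y, ·⟩ dμ)` with `φ = truncAbs ρ`. -/
noncomputable def truncDeviation {n k : ℕ} (μ : Measure (EuclideanSpace ℝ (Fin n))) (ρ : ℝ)
    (x : Fin k → EuclideanSpace ℝ (Fin n)) (y : EuclideanSpace ℝ (Fin n)) : ℝ :=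
  ∑ i, (truncAbs ρ (inner ℝ y (x i)) - ∫ z, truncAbs ρ (inner ℝ y z) ∂μ)

theorem truncDeviation_zero {n k : ℕ} (μ : Measure (EuclideanSpace ℝ (Fin n))) (ρ : ℝ)
    (x : Fin k → EuclideanSpace ℝ (Fin n)) : truncDeviation μ ρ x 0 = 0 := by
  simp [truncDeviation, truncAbs_zero]

/-- The increments of the truncated process are sub-Gaussian with respect to the `ψ₂` distance. -/
theorem measure_truncDeviation_increment_le {n k : ℕ} (hk : 1 ≤ k)
    {μ : Measure (EuclideanSpace ℝ (Fin n))} [IsProbabilityMeasure μ] (hiso : IsIsotropic μ)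
    {Ω : Type*} [MeasurableSpace Ω] {P : Measure Ω} {X : Fin k → Ω → EuclideanSpace ℝ (Fin n)}
    (hX : ∀ i, HasLaw (X i) μ P) (hind : iIndepFun X P) {ρ : ℝ} (hρ : 0 < ρ) {τ : ℝ} (hτ : 0 < τ)
    (s : ℕ) (a b : EuclideanSpace ℝ (Fin n)) :
    P {ω | ENNReal.ofReal (16 * τ * √k / ρ) * ((2 : ℝ≥0∞) ^ ((s : ℝ) / 2) * psiDist 2 μ a b) <
        ENNReal.ofReal (truncDeviation μ ρ (X · ω) b - truncDeviation μ ρ (X · ω) a)} ≤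
      ENNReal.ofReal (Real.exp (-τ ^ 2) ^ 2 ^ s) := by
  have hk0 : (0 : ℝ) < k := by exact_mod_cast hk
  have hκ : 0 < 16 * τ * √k / ρ := by positivity
  rcases eq_or_ne a b with rfl | hab
  · simp
  by_cases htop : psiDist 2 μ a b = ∞
  · rw [htop, ENNReal.mul_top (by simp [ENNReal.rpow_eq_zero_iff]), ENNReal.mul_top (by simpa)]
    simp
  have hpos : psiDist 2 μ a b ≠ 0 := fun h0 => by
    have h := ofReal_norm_sub_le_psiDist_two hiso a b
    rw [h0, nonpos_iff_eq_zero, ENNReal.ofReal_eq_zero, norm_le_zero_iff, sub_eq_zero] at h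
    exact hab h
  -- Passing to an admissible `u` below twice the infimum avoids showing that it is attained.
  obtain ⟨u, hu, hle, hud⟩ := psiNorm_two_lt_iff.1
    (show psiDist 2 μ a b < 2 * psiDist 2 μ a b by
      rw [two_mul]; exact ENNReal.lt_add_right htop hpos)
  set f : EuclideanSpace ℝ (Fin n) → ℝ :=
    fun x => truncAbs ρ (inner ℝ b x) - truncAbs ρ (inner ℝ a x) with hf
  have hv : 0 < 2 * u / ρ := by positivity
  have hfv : ∫⁻ x, ENNReal.ofReal (Real.exp (f x ^ 2 / (2 * u / ρ) ^ 2)) ∂μ ≤ 2 := by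
    refine (lintegral_mono fun x => ENNReal.ofReal_le_ofReal (Real.exp_le_exp.2 ?_)).trans hle
    rw [← div_pow, ← div_pow, sq_le_sq, abs_div (f x), abs_div (inner ℝ a x - _),
      abs_of_pos hv, abs_of_pos hu, abs_sub_comm (inner ℝ a x)]
    refine (div_le_div_of_nonneg_right (abs_truncAbs_sub_le hρ _ _) hv.le).trans_eq ?_
    field_simp
  have hconc := measure_sum_sub_integral_ge_le hX hind (f := f) (by fun_prop)
    (fun x => abs_truncAbs_sub_le_one hρ _ _) hv hfv
    (ε := 4 * (2 * u / ρ) * √k * τ * 2 ^ ((s : ℝ) / 2)) (by positivity)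
  have hsq : ((2 : ℝ) ^ ((s : ℝ) / 2)) ^ 2 = 2 ^ s := by
    rw [← Real.rpow_natCast, ← Real.rpow_mul (by norm_num)]
    simp
  have hexp : -(4 * (2 * u / ρ) * √k * τ * 2 ^ ((s : ℝ) / 2)) ^ 2 /
      (16 * k * (2 * u / ρ) ^ 2) = ((2 ^ s : ℕ) : ℝ) * -τ ^ 2 := by
    simp only [mul_pow, hsq, Real.sq_sqrt hk0.le]
    push_cast
    field_simp
    norm_num
  rw [hexp, Real.exp_nat_mul] at hconc
  refine (measure_mono fun ω hω => ?_).trans hconc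
  rw [Set.mem_ofPred_eq] at hω ⊢
  have hdiff : truncDeviation μ ρ (X · ω) b - truncDeviation μ ρ (X · ω) a =
      ∑ i, (f (X i ω) - ∫ x, f x ∂μ) := by
    rw [truncDeviation, truncDeviation, ← Finset.sum_sub_distrib]
    refine Finset.sum_congr rfl fun i _ => ?_
    rw [hf, integral_sub (integrable_truncAbs_inner μ hρ b) (integrable_truncAbs_inner μ hρ a)]
    ring
  rw [hdiff] at hω
  have h2 : ENNReal.ofReal (4 * (2 * u / ρ) * √k * τ * 2 ^ ((s : ℝ) / 2)) ≤
      ENNReal.ofReal (16 * τ * √k / ρ) * ((2 : ℝ≥0∞) ^ ((s : ℝ) / 2) * psiDist 2 μ a b) := by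
    have hu2 : ENNReal.ofReal (u / 2) ≤ psiDist 2 μ a b := by
      rw [ENNReal.ofReal_div_of_pos two_pos, ENNReal.ofReal_ofNat]
      exact ENNReal.div_le_of_le_mul' hud.le
    calc ENNReal.ofReal (4 * (2 * u / ρ) * √k * τ * 2 ^ ((s : ℝ) / 2))
        = ENNReal.ofReal (16 * τ * √k / ρ) *
            ((2 : ℝ≥0∞) ^ ((s : ℝ) / 2) * ENNReal.ofReal (u / 2)) := by
          rw [← ENNReal.ofReal_ofNat 2, ENNReal.ofReal_rpow_of_pos two_pos,
            ← ENNReal.ofReal_mul (by positivity), ← ENNReal.ofReal_mul (by positivity)]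
          congr 1
          ring
      _ ≤ _ := by gcongr
  exact ((ENNReal.ofReal_lt_ofReal_iff_of_nonneg (by positivity)).1 (h2.trans_lt hω)).le

/-- A symmetric subset of the sphere of radius `ρ` whose `γ₂` functional is small compared with
`ρ √k` is missed by the common kernel of `k` independent random functionals. -/
theorem measure_exists_forall_inner_eq_zero_le {n k : ℕ} (hk : 1 ≤ k)
    {μ : Measure (EuclideanSpace ℝ (Fin n))} [IsProbabilityMeasure μ] (hiso : IsIsotropic μ)
    (hμ : IsLogConcaveMeasure μ)
    {Ω : Type*} [MeasurableSpace Ω] {P : Measure Ω} {X : Fin k → Ω → EuclideanSpace ℝ (Fin n)}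
    (hX : ∀ i, HasLaw (X i) μ P) (hind : iIndepFun X P) {ρ : ℝ} (hρ : 0 < ρ)
    {τ δ : ℝ} (hτ : 0 < τ) (hδ0 : 0 ≤ δ) (hδ1 : δ ≤ 1) (hτδ : Real.exp (-τ ^ 2) = δ / 32)
    {T : Set (EuclideanSpace ℝ (Fin n))} (hTρ : ∀ t ∈ T, ‖t‖ = ρ) (hTsymm : ∀ t ∈ T, -t ∈ T)
    (hT : talagrandGamma 2 (psiDist 2 μ) T < ENNReal.ofReal (ρ * √k / (2000 * τ))) :
    P {ω | ∃ t ∈ T, ∀ i, inner ℝ t (X i ω) = 0} ≤ ENNReal.ofReal δ := by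
  have hk0 : (0 : ℝ) < k := by exact_mod_cast hk
  set W : ℝ≥0∞ := ENNReal.ofReal (ρ * √k / (2000 * τ)) with hWdef
  have hW : W ≠ ∞ := ENNReal.ofReal_ne_top
  set κ : ℝ≥0∞ := ENNReal.ofReal (16 * τ * √k / ρ) with hκdef
  have hκW : κ * W = ENNReal.ofReal (k / 125) := by
    rw [hκdef, hWdef, ← ENNReal.ofReal_mul (by positivity)]
    congr 1
    field_simp
    rw [Real.sq_sqrt hk0.le]
    ring
  rcases T.eq_empty_or_nonempty with rfl | ⟨t₀, ht₀⟩
  · simp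
  simp only [talagrandGamma, iInf_lt_iff] at hT
  obtain ⟨S, hS, hSW⟩ := hT
  have hSt : ∀ t ∈ T, ∑' s : ℕ, (2 : ℝ≥0∞) ^ ((s : ℝ) / 2) * ⨅ a ∈ S s, psiDist 2 μ t a ≤ W :=
    fun t ht => (le_iSup₂ (f := fun t (_ : t ∈ T) =>
      ∑' s : ℕ, (2 : ℝ≥0∞) ^ ((s : ℝ) / 2) * ⨅ a ∈ S s, psiDist 2 μ t a) t ht).trans hSW.le
  obtain ⟨a, ha⟩ : ∃ a, a ∈ S 0 :=
    let ⟨π, hπ, _⟩ := exists_chain hS hW (hSt t₀ ht₀)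
    ⟨π 0, hπ 0⟩
  have hroot : ∀ b ∈ S 0, b = a := fun b hb => Set.encard_le_one_iff.1 hS.card_zero b a hb ha
  -- The chains start at the root `a`; one further link joins it to the origin, where the process
  -- vanishes. Its length is controlled because `-a` also belongs to `T`.
  have ha0 : psiDist 2 μ a 0 ≤ W := by
    obtain ⟨π, hπ, hπW⟩ := exists_chain hS hW (hSt (-a) (hTsymm a (hS.subset 0 ha)))
    have h := (ENNReal.le_tsum 0).trans hπW
    rw [hroot _ (hπ 0)] at h
    simp only [Nat.cast_zero, zero_div, ENNReal.rpow_zero, one_mul] at h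
    exact (psiDist_two_zero_le μ a).trans h
  set E : ℕ → EuclideanSpace ℝ (Fin n) → EuclideanSpace ℝ (Fin n) → Set Ω := fun s a b =>
    {ω | κ * ((2 : ℝ≥0∞) ^ ((s : ℝ) / 2) * psiDist 2 μ a b) <
      ENNReal.ofReal (truncDeviation μ ρ (X · ω) b - truncDeviation μ ρ (X · ω) a)} with hEdef
  have hE : ∀ s a b, P (E s a b) ≤ ENNReal.ofReal ((δ / 4 / 8) ^ 2 ^ s) := fun s a b => by
    have h := measure_truncDeviation_increment_le hk hiso hX hind hρ hτ s a b
    rwa [hτδ, show δ / 32 = δ / 4 / 8 by ring] at h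
  have hbad : P (E 0 a 0 ∪ ⋃ s, ⋃ a ∈ S (s + 1), ⋃ b ∈ S s, E s a b) ≤ ENNReal.ofReal δ := by
    refine (measure_union_le _ _).trans ((add_le_add (hE 0 a 0)
      (measure_iUnion_links_le hS (by linarith) (by linarith) E hE)).trans ?_)
    rw [← ENNReal.ofReal_add (by positivity) (by positivity)]
    refine ENNReal.ofReal_le_ofReal ?_
    norm_num
    linarith
  refine (measure_mono ?_).trans hbad
  rintro ω ⟨t, ht, hzero⟩
  by_contra hω
  simp only [hEdef, Set.mem_union, Set.mem_iUnion, Set.mem_ofPred_eq, not_or, not_exists,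
    not_lt] at hω
  obtain ⟨hω0, hωs⟩ := hω
  obtain ⟨π, hπ, hπW⟩ := exists_chain hS hW (hSt t ht)
  have hlower : ∀ m, -truncDeviation μ ρ (X · ω) (π m) ≤ k / 125 + (k / 125 + k / 125) := by
    intro m
    have h1 := ofReal_sub_le_of_chain (psiDist_two_comm μ) (psiDist_two_triangle μ) hπW
      (g := truncDeviation μ ρ (X · ω)) (fun s => hωs s _ (hπ (s + 1)) _ (hπ s)) m
    have h0 : ENNReal.ofReal (truncDeviation μ ρ (X · ω) 0 - truncDeviation μ ρ (X · ω) a) ≤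
        κ * W := by
      refine hω0.trans ?_
      gcongr
      simpa using ha0
    rw [hroot _ (hπ 0), mul_add, hκW, ← ENNReal.ofReal_add (by positivity) (by positivity),
      ENNReal.ofReal_le_ofReal_iff (by positivity)] at h1
    rw [hκW, truncDeviation_zero, ENNReal.ofReal_le_ofReal_iff (by positivity)] at h0
    linarith
  have hconv : Filter.Tendsto π Filter.atTop (nhds t) := by
    rw [tendsto_iff_norm_sub_tendsto_zero]
    have h := (ENNReal.tendsto_toReal ENNReal.zero_ne_top).comp (tendsto_zero_of_chain hW hπW)
    refine squeeze_zero_norm' ?_ h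
    have hfin := (ENNReal.tendsto_nhds_zero.1 (tendsto_zero_of_chain hW hπW)) 1 one_pos
    filter_upwards [hfin] with s hs
    rw [norm_norm, norm_sub_rev]
    exact (ENNReal.ofReal_le_iff_le_toReal (ne_top_of_le_ne_top ENNReal.one_ne_top hs)).1
      (ofReal_norm_sub_le_psiDist_two hiso _ _)
  have hlim : Filter.Tendsto (fun m => ∑ i, truncAbs ρ (inner ℝ (π m) (X i ω))) Filter.atTop
      (nhds 0) := by
    have hc : Continuous fun y : EuclideanSpace ℝ (Fin n) =>
        ∑ i, truncAbs ρ (inner ℝ y (X i ω)) := by fun_prop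
    have h := (hc.tendsto t).comp hconv
    simpa [Function.comp_def, hzero, truncAbs_zero] using h
  obtain ⟨m, hm⟩ := (hlim.eventually_lt_const (show (0 : ℝ) < k / 40 by positivity)).exists
  have hmean := one_div_twenty_le_integral_truncAbs hiso hμ hρ (hTρ _ (hS.subset m (hπ m)))
  have hZ := hlower m
  rw [truncDeviation, Finset.sum_sub_distrib, Finset.sum_const, Finset.card_univ, Fintype.card_fin,
    nsmul_eq_mul] at hZ
  nlinarith

/-! ### Passage to the critical radius -/

theorem exists_gammaSection_eq_zero {n : ℕ} (μ : Measure (EuclideanSpace ℝ (Fin n)))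
    {K : Set (EuclideanSpace ℝ (Fin n))} (hK : IsCompact K) :
    ∃ ρ : ℝ, 0 < ρ ∧ gammaSection μ K ρ = 0 := by
  obtain ⟨R, hR⟩ := hK.isBounded.exists_norm_le
  have hempty : K ∩ Metric.sphere 0 (|R| + 1) = ∅ := by
    refine Set.eq_empty_of_forall_notMem fun x hx => ?_
    have h := hR x hx.1
    rw [mem_sphere_zero_iff_norm.1 hx.2] at h
    linarith [le_abs_self R]
  exact ⟨|R| + 1, by positivity, by rw [gammaSection, hempty, talagrandGamma_empty]⟩

/-- A weight that is at least `1` only enlarges the critical radius. -/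
theorem sInf_le_qStar {n k : ℕ} (hk : 1 ≤ k) {μ : Measure (EuclideanSpace ℝ (Fin n))}
    {K : Set (EuclideanSpace ℝ (Fin n))} (hK : IsCompact K) {w : ℝ → ℝ} (hw : ∀ v, 1 ≤ w v)
    {τ : ℝ} (hτ : 0 < τ) :
    sInf {ρ : ℝ | 0 < ρ ∧ gammaSection μ K ρ < ENNReal.ofReal (ρ * √k / (2000 * τ))} ≤
      qStar w (4000 * τ) k μ K := by
  have hk0 : (0 : ℝ) < k := by exact_mod_cast hk
  obtain ⟨r, hr, hγ⟩ := exists_gammaSection_eq_zero μ hK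
  refine csInf_le_csInf ⟨0, fun ρ hρ => hρ.1.le⟩ ⟨r, hr, by simp [hγ], by simp [hγ, hr.le]⟩ ?_
  rintro ρ ⟨hρ, hfin, hle⟩
  refine ⟨hρ, ?_⟩
  rw [← ENNReal.ofReal_toReal hfin, ENNReal.ofReal_lt_ofReal_iff (by positivity)]
  set V := (gammaSection μ K ρ).toReal with hV
  have hV0 : 0 ≤ V := ENNReal.toReal_nonneg
  have h1 : 4000 * τ * V * (1 / √k) ≤ ρ := by
    refine le_trans ?_ hle
    rw [one_div, ← Real.sqrt_inv, ← one_div]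
    gcongr
    exact hw V
  rw [mul_one_div, div_le_iff₀ (by positivity)] at h1
  rw [lt_div_iff₀ (by positivity)]
  have : 0 < ρ * √k := by positivity
  linarith

theorem sampleOperator_apply {n k : ℕ} (x : Fin k → EuclideanSpace ℝ (Fin n))
    (y : EuclideanSpace ℝ (Fin n)) (j : Fin k) : sampleOperator x y j = inner ℝ (x j) y := by
  simp [sampleOperator, Finset.sum_apply, Pi.single_apply]

theorem theorem4p2 (δ : ℝ) (hδ0 : 0 < δ) (hδ1 : δ < 1) :
    ∃ c : ℝ, 0 < c ∧
      ∀ (n k : ℕ), 1 ≤ k →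
      ∀ (μ : Measure (EuclideanSpace ℝ (Fin n))) [IsProbabilityMeasure μ],
        IsIsotropic μ → IsLogConcaveMeasure μ →
      ∀ K : Set (EuclideanSpace ℝ (Fin n)), IsConvexSymmetricBody K →
      ∀ (Ω : Type*) [MeasurableSpace Ω] (P : Measure Ω) [IsProbabilityMeasure P]
        (X : Fin k → Ω → EuclideanSpace ℝ (Fin n)),
        (∀ i, HasLaw (X i) μ P) → iIndepFun X P →
        ENNReal.ofReal (1 - δ) ≤
          P {ω | Metric.diam
                  ((LinearMap.ker (sampleOperator fun i => X i ω) :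
                    Set (EuclideanSpace ℝ (Fin n))) ∩ K)
                    ≤ 2 * qStar (fun v => max 1 (Real.log v)) c k μ K ∧
                 Metric.diam
                  ((LinearMap.ker (sampleOperator fun i => X i ω) :
                    Set (EuclideanSpace ℝ (Fin n))) ∩ K)
                    ≤ 2 * qStar (fun v => max 1 v) c k μ K} := by
  set τ := √(Real.log (32 / δ)) with hτdef
  have hlog : 0 < Real.log (32 / δ) := Real.log_pos (by rw [lt_div_iff₀ hδ0]; linarith)
  have hτ : 0 < τ := Real.sqrt_pos.2 hlog
  have hτδ : Real.exp (-τ ^ 2) = δ / 32 := by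
    rw [hτdef, Real.sq_sqrt hlog.le, Real.exp_neg, Real.exp_log (by positivity), inv_div]
  refine ⟨4000 * τ, by positivity, ?_⟩
  intro n k hk μ _ hiso hμ K hK Ω _ P _ X hX hind
  set R := {ρ : ℝ | 0 < ρ ∧ gammaSection μ K ρ < ENNReal.ofReal (ρ * √k / (2000 * τ))} with hR
  have hle1 : sInf R ≤ qStar (fun v => max 1 (Real.log v)) (4000 * τ) k μ K :=
    sInf_le_qStar hk hK.isCompact (fun _ => le_max_left _ _) hτ
  have hle2 : sInf R ≤ qStar (fun v => max 1 v) (4000 * τ) k μ K :=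
    sInf_le_qStar hk hK.isCompact (fun _ => le_max_left _ _) hτ
  have hk0 : (0 : ℝ) < k := by exact_mod_cast hk
  have hRne : R.Nonempty := by
    obtain ⟨r, hr, hγ⟩ := exists_gammaSection_eq_zero μ hK.isCompact
    exact ⟨r, hr, by rw [hγ, ENNReal.ofReal_pos]; positivity⟩
  have hR0 : 0 ≤ sInf R := Real.sInf_nonneg fun ρ hρ => hρ.1.le
  obtain ⟨u, hanti, htend, huR⟩ := exists_seq_tendsto_sInf hRne ⟨0, fun ρ hρ => hρ.1.le⟩
  -- The infimum need not be attained, so the exceptional set is an increasing union over radii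
  -- decreasing to it.
  set B : ℕ → Set Ω := fun j => {ω | ∃ x ∈ K, (∀ i, inner ℝ x (X i ω) = 0) ∧ u j ≤ ‖x‖} with hB
  have hBmono : Monotone B := fun i j hij ω ⟨x, hxK, hx0, hx⟩ => ⟨x, hxK, hx0, (hanti hij).trans hx⟩
  have hzero : (0 : EuclideanSpace ℝ (Fin n)) ∈ K := by
    obtain ⟨x, hx⟩ := hK.interior_nonempty
    have hx := interior_subset hx
    have h := hK.convex hx (hK.symm x hx) (show (0 : ℝ) ≤ 1 / 2 by norm_num)
      (show (0 : ℝ) ≤ 1 / 2 by norm_num) (by norm_num)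
    simpa using h
  have hBle : ∀ j, P (B j) ≤ ENNReal.ofReal δ := by
    intro j
    obtain ⟨huj, hγ⟩ := huR j
    refine (measure_mono ?_).trans (measure_exists_forall_inner_eq_zero_le hk hiso hμ hX hind huj hτ
      hδ0.le hδ1.le hτδ (T := K ∩ Metric.sphere 0 (u j))
      (fun t ht => mem_sphere_zero_iff_norm.1 ht.2)
      (fun t ht => ⟨hK.symm t ht.1, by simpa using ht.2⟩)
      hγ)
    rintro ω ⟨x, hxK, hx0, hx⟩
    have hxpos : 0 < ‖x‖ := huj.trans_le hx
    refine ⟨(u j / ‖x‖) • x, ⟨?_, ?_⟩, fun i => by rw [real_inner_smul_left, hx0, mul_zero]⟩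
    · exact hK.convex.smul_mem_of_zero_mem hzero hxK
        ⟨by positivity, (div_le_one hxpos).2 hx⟩
    · rw [mem_sphere_zero_iff_norm, norm_smul, Real.norm_of_nonneg (by positivity),
        div_mul_cancel₀ _ hxpos.ne']
  have hBU : P (⋃ j, B j) ≤ ENNReal.ofReal δ := by
    rw [hBmono.measure_iUnion]
    exact iSup_le hBle
  have hgood : ENNReal.ofReal (1 - δ) ≤ P (⋃ j, B j)ᶜ := by
    rw [ENNReal.ofReal_sub _ hδ0.le, ENNReal.ofReal_one, tsub_le_iff_left]
    have h := measure_univ_le_add_compl (μ := P) (⋃ j, B j)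
    rw [measure_univ] at h
    exact h.trans (by gcongr)
  refine hgood.trans (measure_mono fun ω hω => ?_)
  have hnorm : ∀ x ∈ (LinearMap.ker (sampleOperator fun i => X i ω) :
      Set (EuclideanSpace ℝ (Fin n))) ∩ K, ‖x‖ ≤ sInf R := by
    rintro x ⟨hker, hxK⟩
    refine ge_of_tendsto' htend fun j => ?_
    by_contra! hlt
    refine hω (Set.mem_iUnion.2 ⟨j, x, hxK, fun i => ?_, hlt.le⟩)
    rw [real_inner_comm, ← sampleOperator_apply (fun i => X i ω),
      LinearMap.mem_ker.1 (SetLike.mem_coe.1 hker)]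
    rfl
  have hdiam : Metric.diam ((LinearMap.ker (sampleOperator fun i => X i ω) :
      Set (EuclideanSpace ℝ (Fin n))) ∩ K) ≤ 2 * sInf R := by
    refine Metric.diam_le_of_forall_dist_le (by positivity) fun x hx y hy => ?_
    rw [two_mul]
    exact (dist_le_norm_add_norm x y).trans (add_le_add (hnorm x hx) (hnorm y hy))
  exact ⟨by linarith, by linarith⟩
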